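/- Let $1<p<\infty$, $0<\beta'\le\beta$, and let $W_1,W_2:\mathbb{R}^{3\times3}\to\mathbb{R}$ be continuous functions with $$\beta'(|F|^p-1)\le W_i(F)\le\beta(1+|F|^p)\qquad\text{for all }F\in\mathbb{R}^{3\times3},\ i=1,2,$$ where $|\cdot|$ is the Euclidean (Frobenius) norm of matrices. For $\overline F\in\mathbb{R}^{3\times2}$ and $c\in\mathbb{R}^3$ let $(\overline F|c)\in\mathbb{R}^{3\times3}$ be the matrix whose first two columns are those of $\overline F$ and whose last column is $c$. Put $\overline W_i(\overline F):=\inf_{c\in\mathbb{R}^3}W_i(\overline F|c)$ and, for $\chi\in\{0,1\}$, $$\overline V(\chi,\overline F):=\chi\,\overline W_1(\overline F)+(1-\chi)\,\overline W_2(\overline F),$$ $$Q\overline V(\chi,\overline F):=\inf\Big\{\int_{Q'}\overline V(\chi,\overline F+\nabla\varphi)\,dx:\ \varphi\in W^{1,p}_0(Q';\mathbb{R}^3)\Big\},$$ where $Q'=(0,1)^2$ and $W^{1,p}_0(Q';\mathbb{R}^3)$ is the closure of $C_c^\infty(Q';\mathbb{R}^3)$ in $W^{1,p}(Q';\mathbb{R}^3)$.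 Then: 1. $Q\overline V$ is continuous on $\{0,1\}\times\mathbb{R}^{3\times2}$; 2. with the same constants $\beta',\beta$ as above, $\beta'(|\overline F|^p-1)\le Q\overline V(\chi,\overline F)\le\beta(1+|\overline F|^p)$ for all $\chi\in\{0,1\}$ and $\overline F\in\mathbb{R}^{3\times2}$; 3. there is a constant $C>0$ such that $|Q\overline V(\chi,\overline F)-Q\overline V(\chi',\overline F)|\le C\,|\chi-\chi'|\,(1+|\overline F|^p)$ for all $\chi,\chi'\in\{0,1\}$ and $\overline F\in\mathbb{R}^{3\times2}$. -/

import Mathlib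

open MeasureTheory Set
open scoped ContDiff

noncomputable section

namespace ThinFilm

/-- The plane `ℝ²` of the variables `x_α = (x₁, x₂)`, with the Euclidean norm and Lebesgue
measure. -/
abbrev Plane : Type := EuclideanSpace ℝ (Fin 2)

/-- The target space `ℝ³` of deformations. -/
abbrev Space : Type := EuclideanSpace ℝ (Fin 3)

/-- The `3 × 2` real matrices, with entries `F (i, j)` (row `i`, column `j`) and the Euclidean
(Frobenius) norm `|F| = (∑ i j, F (i, j) ^ 2) ^ (1/2)`. -/
abbrev Mat32 : Type := EuclideanSpace ℝ (Fin 3 × Fin 2)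

/-- The `3 × 3` real matrices, with the Euclidean (Frobenius) norm. -/
abbrev Mat33 : Type := EuclideanSpace ℝ (Fin 3 × Fin 3)

/-- The open unit square `Q' = (0,1)²`. -/
def unitSquare : Set Plane := {x | ∀ i, x i ∈ Ioo (0 : ℝ) 1}

/-- The matrix `(F̄ | c)`, with first two columns those of `F̄` and last column `c`. -/
def appendCol (F : Mat32) (c : Space) : Mat33 :=
  WithLp.toLp 2 fun ij =>
    !![F (0, 0), F (0, 1), c 0;
       F (1, 0), F (1, 1), c 1;
       F (2, 0), F (2, 1), c 2] ij.1 ij.2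

/-- The growth condition `β' (|F|^p - 1) ≤ W(F) ≤ β (1 + |F|^p)` for all `F ∈ ℝ^{3×3}`. -/
def HasGrowth (p β' β : ℝ) (W : Mat33 → ℝ) : Prop :=
  ∀ F : Mat33, β' * (‖F‖ ^ p - 1) ≤ W F ∧ W F ≤ β * (1 + ‖F‖ ^ p)

/-- The reduced density `W̄(F̄) = inf_{c ∈ ℝ³} W(F̄ | c)`. -/
def reduced (W : Mat33 → ℝ) (F : Mat32) : ℝ := ⨅ c : Space, W (appendCol F c)

/-- The reduced two-phase density `V̄(χ, F̄) = χ W̄₁(F̄) + (1 - χ) W̄₂(F̄)`. -/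
def Vbar (W₁ W₂ : Mat33 → ℝ) (χ : ℝ) (F : Mat32) : ℝ :=
  χ * reduced W₁ F + (1 - χ) * reduced W₂ F

/-- The `j`-th vector of the standard basis of `ℝ²`. -/
def stdVec (j : Fin 2) : Plane := EuclideanSpace.single j (1 : ℝ)

/-- The classical gradient: the `3 × 2` matrix of the partial derivatives `∂_j ψ_i (x)`. -/
def classicalGrad (ψ : Plane → Space) (x : Plane) : Mat32 :=
  WithLp.toLp 2 fun ij => (fderiv ℝ ψ x (stdVec ij.2)) ij.1

/-- `ψ ∈ C_c^∞(U; E)`. -/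
def IsTest {E : Type*} [NormedAddCommGroup E] [NormedSpace ℝ E] (U : Set Plane)
    (ψ : Plane → E) : Prop :=
  ContDiff ℝ ∞ ψ ∧ HasCompactSupport ψ ∧ tsupport ψ ⊆ U

/-- `G` is the weak (distributional) gradient of `φ` in `U`. -/
def IsWeakGrad (U : Set Plane) (φ : Plane → Space) (G : Plane → Mat32) : Prop :=
  ∀ η : Plane → ℝ, IsTest U η → ∀ (i : Fin 3) (j : Fin 2),
    ∫ x in U, φ x i * fderiv ℝ η x (stdVec j) = - ∫ x in U, G x (i, j) * η x

/-- `φ ∈ W^{1,p}(U; ℝ³)`, with weak gradient `G`. -/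
def MemW1p (p : ℝ) (U : Set Plane) (φ : Plane → Space) (G : Plane → Mat32) : Prop :=
  MemLp φ (ENNReal.ofReal p) (volume.restrict U) ∧
  MemLp G (ENNReal.ofReal p) (volume.restrict U) ∧
  IsWeakGrad U φ G

/-- `φ ∈ W_0^{1,p}(U; ℝ³)`, with weak gradient `G`: the closure of `C_c^∞(U; ℝ³)` in
`W^{1,p}(U; ℝ³)`. -/
def MemW01p (p : ℝ) (U : Set Plane) (φ : Plane → Space) (G : Plane → Mat32) : Prop :=
  MemW1p p U φ G ∧
  ∀ ε : ℝ, 0 < ε → ∃ ψ : Plane → Space, IsTest U ψ ∧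
    eLpNorm (fun x => φ x - ψ x) (ENNReal.ofReal p) (volume.restrict U) < ENNReal.ofReal ε ∧
    eLpNorm (fun x => G x - classicalGrad ψ x) (ENNReal.ofReal p) (volume.restrict U)
      < ENNReal.ofReal ε

/-- The quasiconvexification in the second variable,
`QV̄(χ, F̄) = inf { ∫_{Q'} V̄(χ, F̄ + ∇φ) dx : φ ∈ W_0^{1,p}(Q'; ℝ³) }`. -/
def QVbar (p : ℝ) (W₁ W₂ : Mat33 → ℝ) (χ : ℝ) (F : Mat32) : ℝ :=
  sInf {t : ℝ | ∃ (φ : Plane → Space) (G : Plane → Mat32), MemW01p p unitSquare φ G ∧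
    t = ∫ x in unitSquare, Vbar W₁ W₂ χ (F + G x)}

end ThinFilm

end

namespace ThinFilm

open Filter Topology

/-! For χ ∈ {0,1} the density V̄(χ,·) is one of the two reduced densities. Each is continuous with
p-growth and the same constants: by coercivity the infimum over c is attained in a ball that is
locally uniform in F. All claims thus reduce to the envelope QV of a single such V.

Growth of QV: the zero competitor gives the upper bound. A W_0^{1,p} gradient has zero mean, so
Jensen's inequality for |·|^p gives the lower bound without loss in the constant
(`IsDensity.le_integral`).

Continuity of QV is proved without rank-one convexity, by comparing competitors. A smooth competitor
for F' is shrunk to a concentric square of side a < 1, and a cut-off linear map with matrix F' - F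
is added. This is a competitor for F: it sees the old energy times a² inside and pays at most the
p-growth bound on a frame of area 1 - a² (`IsDensity.exists_qcEnvelope_le`). Fixing a near 1, then
letting F' → F and exchanging roles, gives continuity. Passing to smooth competitors is a Fatou
argument (`IsDensity.exists_isTest_integral_lt`).

The estimate in χ is then just the growth bound, since distinct phases are at distance 1. -/

lemma norm_sq_appendCol (F : Mat32) (c : Space) :
    ‖appendCol F c‖ ^ 2 = ‖F‖ ^ 2 + ‖c‖ ^ 2 := by
  simp only [EuclideanSpace.norm_sq_eq, Fintype.sum_prod_type, Fin.sum_univ_succ, appendCol]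
  simp
  ring

lemma norm_le_norm_appendCol (F : Mat32) (c : Space) : ‖F‖ ≤ ‖appendCol F c‖ := by
  have h := norm_sq_appendCol F c
  nlinarith [norm_nonneg F, norm_nonneg (appendCol F c), sq_nonneg ‖c‖]

lemma norm_col_le_norm_appendCol (F : Mat32) (c : Space) : ‖c‖ ≤ ‖appendCol F c‖ := by
  have h := norm_sq_appendCol F c
  nlinarith [norm_nonneg c, norm_nonneg (appendCol F c), sq_nonneg ‖F‖]

lemma norm_appendCol_zero (F : Mat32) : ‖appendCol F 0‖ = ‖F‖ := by
  have h := norm_sq_appendCol F 0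
  simp only [norm_zero, ne_eq, OfNat.ofNat_ne_zero, not_false_eq_true, zero_pow, add_zero] at h
  exact (pow_left_inj₀ (norm_nonneg _) (norm_nonneg _) two_ne_zero).1 h

lemma continuous_appendCol : Continuous fun q : Mat32 × Space => appendCol q.1 q.2 := by
  unfold appendCol
  refine (PiLp.continuous_toLp 2 _).comp (continuous_pi fun ij => ?_)
  obtain ⟨i, j⟩ := ij
  fin_cases i <;> fin_cases j <;> simp <;> fun_prop

/-! ### Growth and continuity of the reduced density -/

section Growth

variable {p β' β : ℝ} {W : Mat33 → ℝ}

lemma HasGrowth.lower_le_appendCol (hp : 0 < p) (hβ' : 0 < β') (hg : HasGrowth p β' β W)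
    (F : Mat32) (c : Space) : β' * (‖F‖ ^ p - 1) ≤ W (appendCol F c) := by
  refine le_trans ?_ (hg (appendCol F c)).1
  have := norm_le_norm_appendCol F c
  gcongr

lemma HasGrowth.bddBelow (hp : 0 < p) (hβ' : 0 < β') (hg : HasGrowth p β' β W) (F : Mat32) :
    BddBelow (range fun c : Space => W (appendCol F c)) :=
  ⟨_, by rintro _ ⟨c, rfl⟩; exact hg.lower_le_appendCol hp hβ' F c⟩

lemma HasGrowth.le_reduced (hp : 0 < p) (hβ' : 0 < β') (hg : HasGrowth p β' β W) (F : Mat32) :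
    β' * (‖F‖ ^ p - 1) ≤ reduced W F :=
  le_ciInf fun c => hg.lower_le_appendCol hp hβ' F c

lemma HasGrowth.reduced_le (hp : 0 < p) (hβ' : 0 < β') (hg : HasGrowth p β' β W) (F : Mat32) :
    reduced W F ≤ β * (1 + ‖F‖ ^ p) := by
  refine (ciInf_le (hg.bddBelow hp hβ' F) 0).trans ?_
  simpa [norm_appendCol_zero] using (hg (appendCol F 0)).2

/-- The infimum defining `reduced W` may be restricted to a ball, uniformly for `F` in a ball. -/
lemma HasGrowth.exists_reduced_eq_sInf_closedBall (hp : 0 < p) (hβ' : 0 < β') (hβ : 0 ≤ β)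
    (hg : HasGrowth p β' β W) (M : ℝ) :
    ∃ R : ℝ, ∀ F : Mat32, ‖F‖ ≤ M →
      reduced W F = sInf ((fun c => W (appendCol F c)) '' Metric.closedBall 0 R) := by
  -- Outside the ball of radius R the lower growth bound already exceeds the upper bound for the
  -- value at c = 0, so such c are irrelevant to the infimum.
  obtain ⟨R, hR0, hR⟩ : ∃ R : ℝ, 0 ≤ R ∧ β * (1 + M ^ p) ≤ β' * (R ^ p - 1) := by
    have : Tendsto (fun R : ℝ => β' * (R ^ p - 1)) atTop atTop :=
      (tendsto_atTop_add_const_right _ (-1) (tendsto_rpow_atTop hp)).const_mul_atTop hβ'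
    obtain ⟨R, h1, h2⟩ :=
      ((eventually_ge_atTop (0 : ℝ)).and (this.eventually_ge_atTop (β * (1 + M ^ p)))).exists
    exact ⟨R, h1, h2⟩
  refine ⟨R, fun F hF => ?_⟩
  have hbdd : BddBelow ((fun c => W (appendCol F c)) '' Metric.closedBall 0 R) :=
    (hg.bddBelow hp hβ' F).mono (image_subset_range _ _)
  have h0 : (0 : Space) ∈ Metric.closedBall (0 : Space) R := Metric.mem_closedBall_self hR0
  refine le_antisymm ?_ (le_ciInf fun c => ?_)
  · refine le_csInf ⟨_, mem_image_of_mem _ h0⟩ ?_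
    rintro _ ⟨c, -, rfl⟩
    exact ciInf_le (hg.bddBelow hp hβ' F) c
  · by_cases hc : c ∈ Metric.closedBall (0 : Space) R
    · exact csInf_le hbdd (mem_image_of_mem _ hc)
    · refine (csInf_le hbdd (mem_image_of_mem _ h0)).trans ?_
      have hcR : R ≤ ‖appendCol F c‖ := by
        rw [mem_closedBall_zero_iff, not_le] at hc
        exact hc.le.trans (norm_col_le_norm_appendCol F c)
      calc W (appendCol F 0) ≤ β * (1 + ‖F‖ ^ p) := by
            simpa [norm_appendCol_zero] using (hg (appendCol F 0)).2
        _ ≤ β * (1 + M ^ p) := by gcongr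
        _ ≤ β' * (R ^ p - 1) := hR
        _ ≤ β' * (‖appendCol F c‖ ^ p - 1) := by gcongr
        _ ≤ W (appendCol F c) := (hg _).1

/-- Near each F₀ the infimum runs over one fixed compact ball, and an infimum of a jointly
continuous function over a compact set is continuous in the parameter. -/
lemma HasGrowth.continuous_reduced (hp : 0 < p) (hβ' : 0 < β') (hβ : 0 ≤ β)
    (hg : HasGrowth p β' β W) (hW : Continuous W) : Continuous (reduced W) := by
  refine continuous_iff_continuousAt.2 fun F₀ => ?_
  obtain ⟨R, hR⟩ := hg.exists_reduced_eq_sInf_closedBall hp hβ' hβ (‖F₀‖ + 1)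
  have hc : Continuous fun F : Mat32 =>
      sInf ((fun c => W (appendCol F c)) '' Metric.closedBall (0 : Space) R) :=
    (isCompact_closedBall (0 : Space) R).continuous_sInf (hW.comp continuous_appendCol)
  refine hc.continuousAt.congr ?_
  filter_upwards [(continuous_norm.tendsto F₀).eventually (gt_mem_nhds (lt_add_one ‖F₀‖))]
    with F hF
  exact (hR F hF.le).symm

end Growth

/-! ### Matrices, the unit square, and test functions as competitors -/

/-- The matrix of a linear map `ℝ² → ℝ³`, as a continuous linear operation. -/
noncomputable def toMat : (Plane →L[ℝ] Space) →L[ℝ] Mat32 :=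
  LinearMap.toContinuousLinearMap
    { toFun := fun A => WithLp.toLp 2 fun ij => A (stdVec ij.2) ij.1
      map_add' := fun A B => by ext; simp
      map_smul' := fun r A => by ext; simp }

lemma toMat_apply (A : Plane →L[ℝ] Space) (ij : Fin 3 × Fin 2) :
    toMat A ij = A (stdVec ij.2) ij.1 := rfl

lemma classicalGrad_eq (ψ : Plane → Space) (x : Plane) :
    classicalGrad ψ x = toMat (fderiv ℝ ψ x) := rfl

/-- The linear map `ℝ² → ℝ³` with a given matrix. -/
noncomputable def ofMat : Mat32 →L[ℝ] (Plane →L[ℝ] Space) :=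
  ∑ ij : Fin 3 × Fin 2, (EuclideanSpace.proj ij : Mat32 →L[ℝ] ℝ).smulRight
    ((EuclideanSpace.proj ij.2 : Plane →L[ℝ] ℝ).smulRight
      (EuclideanSpace.single ij.1 (1 : ℝ) : Space))

lemma toMat_ofMat (L : Mat32) : toMat (ofMat L) = L := by
  ext ij
  obtain ⟨i, j⟩ := ij
  rw [toMat_apply]
  fin_cases j <;>
    simp [ofMat, stdVec, Fintype.sum_prod_type, Pi.single_apply]

lemma isOpen_unitSquare : IsOpen unitSquare := by
  simp only [unitSquare, ofPred_forall]
  exact isOpen_iInter_of_finite fun i => isOpen_Ioo.preimage (by fun_prop)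

lemma measurableSet_unitSquare : MeasurableSet unitSquare := isOpen_unitSquare.measurableSet

lemma volume_unitSquare : volume unitSquare = 1 := by
  have h : unitSquare = (WithLp.ofLp : Plane → Fin 2 → ℝ) ⁻¹' univ.pi fun _ => Ioo 0 1 := by
    ext x; simp [unitSquare]
  rw [h, (PiLp.volume_preserving_ofLp (Fin 2)).measure_preimage
    (MeasurableSet.univ_pi fun _ => measurableSet_Ioo).nullMeasurableSet]
  simp [Real.volume_pi_Ioo]

instance isProbabilityMeasure_restrict_unitSquare :
    IsProbabilityMeasure (volume.restrict unitSquare) :=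
  ⟨by simp [volume_unitSquare]⟩

section Test

variable {U : Set Plane} {ψ : Plane → Space}

lemma IsTest.continuous_classicalGrad (h : IsTest U ψ) : Continuous (classicalGrad ψ) :=
  toMat.continuous.comp (h.1.continuous_fderiv (by simp))

lemma IsTest.hasCompactSupport_classicalGrad (h : IsTest U ψ) :
    HasCompactSupport (classicalGrad ψ) :=
  (h.2.1.fderiv ℝ).comp_left (g := toMat) (map_zero _)

lemma IsTest.classicalGrad_eq_zero (h : IsTest U ψ) {x : Plane} (hx : x ∉ U) :
    classicalGrad ψ x = 0 := by
  rw [classicalGrad_eq, image_eq_zero_of_notMem_tsupport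
    (fun h' => hx (h.2.2 (tsupport_fderiv_subset ℝ h'))), map_zero]

lemma fderiv_coord (h : IsTest U ψ) (i : Fin 3) (x v : Plane) :
    fderiv ℝ (fun y => ψ y i) x v = fderiv ℝ ψ x v i := by
  have h1 : HasFDerivAt ψ (fderiv ℝ ψ x) x :=
    ((h.1.differentiable (by simp)) x).hasFDerivAt
  have h2 := ((EuclideanSpace.proj i : Space →L[ℝ] ℝ).hasFDerivAt (x := ψ x)).comp x h1
  have h3 : fderiv ℝ (fun y => ψ y i) x
      = (EuclideanSpace.proj i : Space →L[ℝ] ℝ).comp (fderiv ℝ ψ x) := h2.fderiv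
  rw [h3]; rfl

/-- The compact support of ψ removes the boundary terms, so η need only be smooth; the choice η = 1
shows that the gradient of ψ has zero mean. -/
lemma IsTest.integral_mul_fderiv (h : IsTest U ψ) {η : Plane → ℝ} (hη : ContDiff ℝ ∞ η)
    (i : Fin 3) (j : Fin 2) :
    ∫ x in U, ψ x i * fderiv ℝ η x (stdVec j) = - ∫ x in U, classicalGrad ψ x (i, j) * η x := by
  have hψc : Continuous fun x => ψ x i :=
    (EuclideanSpace.proj i : Space →L[ℝ] ℝ).continuous.comp h.1.continuous
  have hψs : HasCompactSupport fun x => ψ x i :=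
    h.2.1.comp_left (g := fun v : Space => v i) rfl
  have hgc : Continuous fun x => classicalGrad ψ x (i, j) :=
    (EuclideanSpace.proj (i, j) : Mat32 →L[ℝ] ℝ).continuous.comp h.continuous_classicalGrad
  have hgs : HasCompactSupport fun x => classicalGrad ψ x (i, j) :=
    h.hasCompactSupport_classicalGrad.comp_left (g := fun v : Mat32 => v (i, j)) rfl
  have hη' : Continuous fun x => fderiv ℝ η x (stdVec j) :=
    (hη.continuous_fderiv (by simp)).clm_apply continuous_const
  have e : ∀ x, fderiv ℝ (fun y => ψ y i) x (stdVec j) = classicalGrad ψ x (i, j) :=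
    fun x => fderiv_coord h i x _
  have hψ0 : ∀ x ∉ U, ψ x = 0 := fun x hx =>
    image_eq_zero_of_notMem_tsupport fun h' => hx (h.2.2 h')
  rw [setIntegral_eq_integral_of_forall_compl_eq_zero fun x hx => by simp [hψ0 x hx],
    setIntegral_eq_integral_of_forall_compl_eq_zero
      fun x hx => by simp [h.classicalGrad_eq_zero hx],
    integral_mul_fderiv_eq_neg_fderiv_mul_of_integrable]
  · simp only [e]
  · simp only [e]
    exact (hgc.mul hη.continuous).integrable_of_hasCompactSupport hgs.mul_right
  · exact (hψc.mul hη').integrable_of_hasCompactSupport hψs.mul_right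
  · exact (hψc.mul hη.continuous).integrable_of_hasCompactSupport hψs.mul_right
  · exact fun x _ => (EuclideanSpace.proj i : Space →L[ℝ] ℝ).differentiableAt.comp x
      (h.1.differentiable (by simp) x)
  · exact fun x _ => hη.differentiable (by simp) x

lemma IsTest.memW01p (h : IsTest U ψ) (p : ℝ) : MemW01p p U ψ (classicalGrad ψ) := by
  refine ⟨⟨(h.1.continuous.memLp_of_hasCompactSupport h.2.1).restrict U,
    (h.continuous_classicalGrad.memLp_of_hasCompactSupport
      h.hasCompactSupport_classicalGrad).restrict U,
    fun η hη i j => h.integral_mul_fderiv hη.1 i j⟩, fun ε hε => ⟨ψ, h, ?_, ?_⟩⟩ <;>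
  simp [hε]

lemma IsTest.integral_classicalGrad (h : IsTest U ψ) : ∫ x in U, classicalGrad ψ x = 0 := by
  have hi : Integrable (classicalGrad ψ) (volume.restrict U) :=
    (h.continuous_classicalGrad.integrable_of_hasCompactSupport
      h.hasCompactSupport_classicalGrad).integrableOn
  ext ⟨i, j⟩
  have h1 := (EuclideanSpace.proj (i, j) : Mat32 →L[ℝ] ℝ).integral_comp_comm hi
  have h2 := h.integral_mul_fderiv (contDiff_const (c := (1 : ℝ))) i j
  simp only [fderiv_fun_const, Pi.zero_apply, zero_apply, mul_zero, integral_zero, mul_one,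
    zero_eq_neg] at h2
  exact h1.symm.trans h2

end Test

lemma isTest_zero (U : Set Plane) : IsTest U (fun _ => (0 : Space)) :=
  ⟨contDiff_const, HasCompactSupport.zero, by
    simp [tsupport]⟩

/-- The zero mean passes from test functions to their closure, because on a probability space the L¹
norm is at most the Lᵖ norm. -/
lemma MemW01p.integral_grad {p : ℝ} (hp : 1 ≤ p) {φ : Plane → Space} {G : Plane → Mat32}
    (h : MemW01p p unitSquare φ G) : ∫ x in unitSquare, G x = 0 := by
  rw [← norm_eq_zero]
  refine le_antisymm (le_of_forall_pos_le_add fun ε hε => ?_) (norm_nonneg _)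
  obtain ⟨ψ, hψ, -, hψG⟩ := h.2 ε hε
  have hp' : (1 : ENNReal) ≤ ENNReal.ofReal p := by simpa using hp
  have hG := h.1.2.1
  have hψL := (hψ.memW01p p).1.2.1
  have hd := hG.sub hψL
  have h1 : ∫ x in unitSquare, G x = ∫ x in unitSquare, (G x - classicalGrad ψ x) := by
    rw [integral_sub (hG.integrable hp') (hψL.integrable hp'), hψ.integral_classicalGrad, sub_zero]
  have h2 : eLpNorm (fun x => G x - classicalGrad ψ x) 1 (volume.restrict unitSquare)
      ≤ ENNReal.ofReal ε :=
    (eLpNorm_le_eLpNorm_of_exponent_le hp' hd.1).trans hψG.le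
  rw [h1, zero_add]
  refine (norm_integral_le_lintegral_norm _).trans ?_
  rw [eLpNorm_one_eq_lintegral_enorm] at h2
  simp only [ofReal_norm]
  exact ENNReal.toReal_le_of_le_ofReal hε.le h2

/-- Fatou's lemma for real integrals, in the presence of convergent upper bounds. -/
lemma integral_le_of_tendsto_ae {α : Type*} [MeasurableSpace α] {μ : Measure α}
    {f : ℕ → α → ℝ} {g : α → ℝ} (hf : ∀ n, Integrable (f n) μ) (hf0 : ∀ n x, 0 ≤ f n x)
    (hg : Integrable g μ) (hg0 : ∀ x, 0 ≤ g x)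
    (hfg : ∀ᵐ x ∂μ, Tendsto (fun n => f n x) atTop (𝓝 (g x)))
    {c : ℕ → ℝ} {c₀ : ℝ} (hc : Tendsto c atTop (𝓝 c₀)) (hfc : ∀ n, ∫ x, f n x ∂μ ≤ c n) :
    ∫ x, g x ∂μ ≤ c₀ := by
  have hc₀ : 0 ≤ c₀ :=
    ge_of_tendsto' hc fun n => (integral_nonneg (hf0 n)).trans (hfc n)
  rw [← ENNReal.ofReal_le_ofReal_iff hc₀,
    ofReal_integral_eq_lintegral_ofReal hg (Eventually.of_forall hg0)]
  calc ∫⁻ x, ENNReal.ofReal (g x) ∂μ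
      = ∫⁻ x, liminf (fun n => ENNReal.ofReal (f n x)) atTop ∂μ := by
        refine lintegral_congr_ae ?_
        filter_upwards [hfg] with x hx
        exact ((ENNReal.continuous_ofReal.tendsto _).comp hx).liminf_eq.symm
    _ ≤ liminf (fun n => ∫⁻ x, ENNReal.ofReal (f n x) ∂μ) atTop :=
        lintegral_liminf_le' fun n => (hf n).aemeasurable.ennreal_ofReal
    _ ≤ liminf (fun n => ENNReal.ofReal (c n)) atTop := by
        refine liminf_le_liminf (Eventually.of_forall fun n => ?_)
        change ∫⁻ x, ENNReal.ofReal (f n x) ∂μ ≤ ENNReal.ofReal (c n)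
        rw [← ofReal_integral_eq_lintegral_ofReal (hf n) (Eventually.of_forall (hf0 n))]
        exact ENNReal.ofReal_le_ofReal (hfc n)
    _ = ENNReal.ofReal c₀ := ((ENNReal.continuous_ofReal.tendsto _).comp hc).liminf_eq

/-- A continuous density on `ℝ^{3×2}` with `p`-growth from above and below. -/
structure IsDensity (p β' β : ℝ) (V : Mat32 → ℝ) : Prop where
  continuous : Continuous V
  lower : ∀ F, β' * (‖F‖ ^ p - 1) ≤ V F
  upper : ∀ F, V F ≤ β * (1 + ‖F‖ ^ p)

/-- The quasiconvex envelope of `V`, defined on the unit square. -/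
noncomputable def qcEnvelope (p : ℝ) (V : Mat32 → ℝ) (F : Mat32) : ℝ :=
  sInf {t : ℝ | ∃ (φ : Plane → Space) (G : Plane → Mat32), MemW01p p unitSquare φ G ∧
    t = ∫ x in unitSquare, V (F + G x)}

/-! ### Smooth competitors and growth of the envelope -/

section

variable {p β' β : ℝ} {V : Mat32 → ℝ}

lemma IsDensity.abs_le (hV : IsDensity p β' β V) (hβ' : 0 < β') (hββ' : β' ≤ β) (F : Mat32) :
    |V F| ≤ β * (1 + ‖F‖ ^ p) := by
  have h0 : 0 ≤ ‖F‖ ^ p := Real.rpow_nonneg (norm_nonneg _) _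
  refine _root_.abs_le.2 ⟨?_, hV.upper F⟩
  have := hV.lower F
  nlinarith [mul_nonneg (hβ'.le.trans hββ') h0, mul_nonneg hβ'.le h0]

lemma integrable_norm_rpow_of_memLp {α E : Type*} [MeasurableSpace α]
    {μ : Measure α} [NormedAddCommGroup E] {G : α → E} (hp : 0 < p)
    (hG : MemLp G (ENNReal.ofReal p) μ) : Integrable (fun x => ‖G x‖ ^ p) μ := by
  have := hG.integrable_norm_rpow (by simpa using hp) ENNReal.ofReal_ne_top
  rwa [ENNReal.toReal_ofReal hp.le] at this

lemma IsDensity.integrable {α : Type*} [MeasurableSpace α]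
    {μ : Measure α} [IsFiniteMeasure μ] (hV : IsDensity p β' β V) (hp : 0 < p) (hβ' : 0 < β')
    (hββ' : β' ≤ β) {G : α → Mat32} (hG : MemLp G (ENNReal.ofReal p) μ) :
    Integrable (fun x => V (G x)) μ := by
  refine (((integrable_const 1).add
    (integrable_norm_rpow_of_memLp hp hG)).const_mul β).mono'
    (hV.continuous.comp_aestronglyMeasurable hG.1) (Eventually.of_forall fun x => ?_)
  exact hV.abs_le hβ' hββ' (G x)

/-- Minkowski's inequality, in the form that supplies the convergent upper bounds for the Fatou
argument below. -/
lemma integral_norm_rpow_le {α : Type*} [MeasurableSpace α] {μ : Measure α} (hp : 1 ≤ p)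
    {A B : α → Mat32} (hA : MemLp A (ENNReal.ofReal p) μ) (hB : MemLp B (ENNReal.ofReal p) μ)
    {δ : ℝ} (hδ : 0 ≤ δ) (h : eLpNorm (A - B) (ENNReal.ofReal p) μ ≤ ENNReal.ofReal δ) :
    ∫ x, ‖B x‖ ^ p ∂μ ≤ ((∫ x, ‖A x‖ ^ p ∂μ) ^ (1 / p) + δ) ^ p := by
  have hp0 : 0 < p := by linarith
  have hp0' : ENNReal.ofReal p ≠ 0 := by simpa using hp0
  have key : ∀ C : α → Mat32, MemLp C (ENNReal.ofReal p) μ →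
      eLpNorm C (ENNReal.ofReal p) μ = ENNReal.ofReal ((∫ x, ‖C x‖ ^ p ∂μ) ^ (1 / p)) := by
    intro C hC
    rw [hC.eLpNorm_eq_integral_rpow_norm hp0' ENNReal.ofReal_ne_top,
      ENNReal.toReal_ofReal hp0.le, one_div]
  have hI : ∀ C : α → Mat32, 0 ≤ ∫ x, ‖C x‖ ^ p ∂μ := fun C =>
    integral_nonneg fun x => Real.rpow_nonneg (norm_nonneg _) _
  have hIA := Real.rpow_nonneg (hI A) (1 / p)
  have h1 : eLpNorm B (ENNReal.ofReal p) μ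
      ≤ ENNReal.ofReal ((∫ x, ‖A x‖ ^ p ∂μ) ^ (1 / p) + δ) := by
    rw [ENNReal.ofReal_add hIA hδ, ← key A hA]
    calc eLpNorm B (ENNReal.ofReal p) μ = eLpNorm (A - (A - B)) (ENNReal.ofReal p) μ := by
          rw [sub_sub_cancel]
      _ ≤ _ := eLpNorm_sub_le hA.1 (hA.1.sub hB.1) (by simpa using hp)
      _ ≤ _ := by gcongr
  rw [key B hB, ENNReal.ofReal_le_ofReal_iff (by positivity)] at h1
  calc ∫ x, ‖B x‖ ^ p ∂μ = ((∫ x, ‖B x‖ ^ p ∂μ) ^ (1 / p)) ^ p := by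
        rw [← Real.rpow_mul (hI B), one_div_mul_cancel hp0.ne', Real.rpow_one]
    _ ≤ _ := Real.rpow_le_rpow (Real.rpow_nonneg (hI B) _) h1 hp0.le

/-- Smooth compactly supported competitors suffice in the definition of the envelope. -/
lemma IsDensity.exists_isTest_integral_lt (hV : IsDensity p β' β V) (hp : 1 ≤ p) (hβ' : 0 < β')
    (hββ' : β' ≤ β) {φ : Plane → Space} {G : Plane → Mat32} (h : MemW01p p unitSquare φ G)
    (F : Mat32) {ε : ℝ} (hε : 0 < ε) :
    ∃ ψ : Plane → Space, IsTest unitSquare ψ ∧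
      ∫ x in unitSquare, V (F + classicalGrad ψ x) < (∫ x in unitSquare, V (F + G x)) + ε := by
  by_contra! hcon
  have hp0 : 0 < p := by linarith
  have hδ : ∀ n : ℕ, 0 < 1 / ((n : ℝ) + 1) := fun n => Nat.one_div_pos_of_nat
  choose ψ hψ _ hψG using fun n : ℕ => h.2 _ (hδ n)
  have hG := h.1.2.1
  have hGψ : ∀ n, MemLp (classicalGrad (ψ n)) (ENNReal.ofReal p) (volume.restrict unitSquare) :=
    fun n => ((hψ n).memW01p p).1.2.1
  have hδ0 : Tendsto (fun n : ℕ => 1 / ((n : ℝ) + 1)) atTop (𝓝 0) :=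
    tendsto_one_div_add_atTop_nhds_zero_nat
  obtain ⟨s, hs, hae⟩ : ∃ s : ℕ → ℕ, StrictMono s ∧ ∀ᵐ x ∂volume.restrict unitSquare,
      Tendsto (fun n => classicalGrad (ψ (s n)) x) atTop (𝓝 (G x)) := by
    refine (tendstoInMeasure_of_tendsto_eLpNorm (p := ENNReal.ofReal p) (by simpa using hp0)
      (fun n => (hGψ n).1) hG.1 ?_).exists_seq_tendsto_ae
    have h0 := (ENNReal.continuous_ofReal.tendsto 0).comp hδ0
    rw [ENNReal.ofReal_zero] at h0
    refine tendsto_of_tendsto_of_tendsto_of_le_of_le tendsto_const_nhds h0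
      (fun n => zero_le) fun n => ?_
    rw [eLpNorm_sub_comm]
    exact (hψG n).le
  have hA : MemLp (fun x => F + G x) (ENNReal.ofReal p) (volume.restrict unitSquare) :=
    (memLp_const F).add hG
  have hB : ∀ n, MemLp (fun x => F + classicalGrad (ψ (s n)) x) (ENNReal.ofReal p)
      (volume.restrict unitSquare) := fun n => (memLp_const F).add (hGψ (s n))
  set N := ∫ x in unitSquare, ‖F + G x‖ ^ p with hN
  have hN0 : 0 ≤ N := integral_nonneg fun x => Real.rpow_nonneg (norm_nonneg _) _
  have hint : ∀ g : Plane → Mat32, MemLp g (ENNReal.ofReal p) (volume.restrict unitSquare) →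
      Integrable (fun x => β * (1 + ‖g x‖ ^ p)) (volume.restrict unitSquare) := fun g hg =>
    ((integrable_const 1).add
      (integrable_norm_rpow_of_memLp hp0 hg)).const_mul β
  have hval : ∀ g : Plane → Mat32, MemLp g (ENNReal.ofReal p) (volume.restrict unitSquare) →
      ∫ x in unitSquare, (β * (1 + ‖g x‖ ^ p) - V (g x))
        = β * (1 + ∫ x in unitSquare, ‖g x‖ ^ p) - ∫ x in unitSquare, V (g x) := by
    intro g hg
    rw [integral_sub (hint g hg) (hV.integrable hp0 hβ' hββ' hg), integral_const_mul,
      integral_add (integrable_const 1)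
        (integrable_norm_rpow_of_memLp hp0 hg)]
    simp
  have hlim : Tendsto (fun n : ℕ => β * (1 + (N ^ (1 / p) + 1 / ((s n : ℝ) + 1)) ^ p)
      - ((∫ x in unitSquare, V (F + G x)) + ε)) atTop
      (𝓝 (β * (1 + N) - ((∫ x in unitSquare, V (F + G x)) + ε))) := by
    have h1 : Tendsto (fun n : ℕ => (N ^ (1 / p) + 1 / ((s n : ℝ) + 1)) ^ p) atTop (𝓝 N) := by
      have := ((hδ0.comp hs.tendsto_atTop).const_add (N ^ (1 / p))).rpow_const
        (p := p) (Or.inr hp0.le)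
      rwa [add_zero, ← Real.rpow_mul hN0, one_div_mul_cancel hp0.ne', Real.rpow_one] at this
    exact ((h1.const_add 1).const_mul β).sub_const _
  -- Fatou is applied to the nonnegative gap β(1 + |·|^p) - V. The p-th moments are controlled by Lᵖ
  -- convergence, so if no test function came within ε, the limit would give gap ≤ gap - ε.
  have hfatou := integral_le_of_tendsto_ae
    (f := fun n x => β * (1 + ‖F + classicalGrad (ψ (s n)) x‖ ^ p)
      - V (F + classicalGrad (ψ (s n)) x))
    (g := fun x => β * (1 + ‖F + G x‖ ^ p) - V (F + G x))
    (fun n => (hint _ (hB n)).sub (hV.integrable hp0 hβ' hββ' (hB n)))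
    (fun n x => sub_nonneg.2 (hV.upper _))
    ((hint _ hA).sub (hV.integrable hp0 hβ' hββ' hA))
    (fun x => sub_nonneg.2 (hV.upper _))
    (by
      filter_upwards [hae] with x hx
      have hx' := hx.const_add F
      exact (((hx'.norm.rpow_const (Or.inr hp0.le)).const_add 1).const_mul β).sub
        ((hV.continuous.tendsto _).comp hx'))
    hlim
    (fun n => by
      rw [hval _ (hB n)]
      have hβ : 0 ≤ β := hβ'.le.trans hββ'
      refine sub_le_sub ?_ (hcon _ (hψ (s n)))
      gcongr
      refine integral_norm_rpow_le hp hA (hB n) (hδ (s n)).le ?_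
      have he : (fun x => F + G x) - (fun x => F + classicalGrad (ψ (s n)) x)
          = fun x => G x - classicalGrad (ψ (s n)) x := by
        ext1 x
        simp
      rw [he]
      exact (hψG (s n)).le)
  rw [hval _ hA] at hfatou
  linarith

/-- Since F + G has mean F, Jensen gives |F|^p ≤ ∫|F + G|^p, and the pointwise lower bound survives
with the same β'. -/
lemma IsDensity.le_integral (hV : IsDensity p β' β V) (hp : 1 ≤ p) (hβ' : 0 < β')
    (hββ' : β' ≤ β) {φ : Plane → Space} {G : Plane → Mat32} (h : MemW01p p unitSquare φ G)
    (F : Mat32) : β' * (‖F‖ ^ p - 1) ≤ ∫ x in unitSquare, V (F + G x) := by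
  have hp0 : 0 < p := by linarith
  have hA : MemLp (fun x => F + G x) (ENNReal.ofReal p) (volume.restrict unitSquare) :=
    (memLp_const F).add h.1.2.1
  have hpint := integrable_norm_rpow_of_memLp hp0 hA
  have hF : ∫ x in unitSquare, (F + G x) = F := by
    rw [integral_add (integrable_const F) (h.1.2.1.integrable (by simpa using hp)),
      h.integral_grad hp]
    simp
  have hA1 := hA.integrable (by simpa using hp)
  have hjensen : ‖F‖ ^ p ≤ ∫ x in unitSquare, ‖F + G x‖ ^ p := by
    have h1 : ‖F‖ ≤ ∫ x in unitSquare, ‖F + G x‖ := by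
      conv_lhs => rw [← hF]
      exact norm_integral_le_integral_norm _
    have h2 := (convexOn_rpow hp).map_integral_le (μ := volume.restrict unitSquare)
      (f := fun x => ‖F + G x‖) (Real.continuous_rpow_const hp0.le).continuousOn isClosed_Ici
      (Eventually.of_forall fun x => norm_nonneg _) hA1.norm hpint
    exact (Real.rpow_le_rpow (norm_nonneg _) h1 hp0.le).trans h2
  calc β' * (‖F‖ ^ p - 1) ≤ β' * ((∫ x in unitSquare, ‖F + G x‖ ^ p) - 1) := by gcongr
    _ = ∫ x in unitSquare, β' * (‖F + G x‖ ^ p - 1) := by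
        rw [integral_const_mul, integral_sub hpint (integrable_const 1)]
        simp
    _ ≤ _ := integral_mono ((hpint.sub (integrable_const 1)).const_mul β')
        (hV.integrable hp0 hβ' hββ' hA) fun x => hV.lower _

lemma IsDensity.qcEnvelope_le_integral (hV : IsDensity p β' β V) (hp : 1 ≤ p) (hβ' : 0 < β')
    (hββ' : β' ≤ β) {φ : Plane → Space} {G : Plane → Mat32} (h : MemW01p p unitSquare φ G)
    (F : Mat32) : qcEnvelope p V F ≤ ∫ x in unitSquare, V (F + G x) :=
  csInf_le ⟨β' * (‖F‖ ^ p - 1), by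
    rintro _ ⟨φ, G, h, rfl⟩; exact hV.le_integral hp hβ' hββ' h F⟩ ⟨φ, G, h, rfl⟩

/-- The zero competitor makes the set of energies nonempty; the real infimum of an empty set would
be 0. -/
lemma le_qcEnvelope {c : ℝ} {F : Mat32} (hc : ∀ φ G, MemW01p p unitSquare φ G →
    c ≤ ∫ x in unitSquare, V (F + G x)) : c ≤ qcEnvelope p V F :=
  le_csInf ⟨_, _, _, (isTest_zero unitSquare).memW01p p, rfl⟩ <| by
    rintro _ ⟨φ, G, h, rfl⟩; exact hc φ G h

/-- The envelope inherits the growth conditions, with the same constants. -/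
lemma IsDensity.qcEnvelope_growth (hV : IsDensity p β' β V) (hp : 1 ≤ p) (hβ' : 0 < β')
    (hββ' : β' ≤ β) (F : Mat32) :
    β' * (‖F‖ ^ p - 1) ≤ qcEnvelope p V F ∧ qcEnvelope p V F ≤ β * (1 + ‖F‖ ^ p) := by
  refine ⟨le_qcEnvelope fun φ G h => hV.le_integral hp hβ' hββ' h F, ?_⟩
  refine (hV.qcEnvelope_le_integral hp hβ' hββ' ((isTest_zero unitSquare).memW01p p) F).trans ?_
  have : ∀ x, classicalGrad (fun _ => (0 : Space)) x = 0 := fun x => by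
    simp [classicalGrad_eq]
  simpa [this] using hV.upper F

lemma IsDensity.abs_qcEnvelope_le (hV : IsDensity p β' β V) (hp : 1 ≤ p) (hβ' : 0 < β')
    (hββ' : β' ≤ β) (F : Mat32) : |qcEnvelope p V F| ≤ β * (1 + ‖F‖ ^ p) := by
  have h0 : 0 ≤ ‖F‖ ^ p := Real.rpow_nonneg (norm_nonneg _) _
  obtain ⟨h1, h2⟩ := hV.qcEnvelope_growth hp hβ' hββ' F
  refine _root_.abs_le.2 ⟨?_, h2⟩
  nlinarith [mul_nonneg (hβ'.le.trans hββ') h0, mul_nonneg hβ'.le h0]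

end

/-! ### Concentric squares, cutoffs and rescaled test functions -/

open scoped Manifold

/-- The lower left corner of the concentric square of side `a`. -/
noncomputable def corner (a : ℝ) : Plane := WithLp.toLp 2 fun _ => (1 - a) / 2

/-- The open square of side `a` concentric with the unit square. -/
def innerSquare (a : ℝ) : Set Plane := {x | ∀ i, x i ∈ Ioo ((1 - a) / 2) ((1 + a) / 2)}

/-- The closed square of side `a` concentric with the unit square. -/
def closedInnerSquare (a : ℝ) : Set Plane := {x | ∀ i, x i ∈ Icc ((1 - a) / 2) ((1 + a) / 2)}

lemma isOpen_innerSquare (a : ℝ) : IsOpen (innerSquare a) := by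
  simp only [innerSquare, ofPred_forall]
  exact isOpen_iInter_of_finite fun i => isOpen_Ioo.preimage (by fun_prop)

lemma isCompact_closedInnerSquare (a : ℝ) : IsCompact (closedInnerSquare a) := by
  have h : closedInnerSquare a = (fun y : Fin 2 → ℝ => (WithLp.toLp 2 y : Plane)) ''
      univ.pi fun _ => Icc ((1 - a) / 2) ((1 + a) / 2) := by
    ext x
    constructor
    · exact fun hx => ⟨WithLp.ofLp x, fun i _ => hx i, rfl⟩
    · rintro ⟨y, hy, rfl⟩ i
      exact hy i (mem_univ i)
  rw [h]
  exact (isCompact_univ_pi fun _ => isCompact_Icc).image (PiLp.continuous_toLp 2 _)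

lemma innerSquare_subset_closedInnerSquare (a : ℝ) : innerSquare a ⊆ closedInnerSquare a :=
  fun _ hx i => Ioo_subset_Icc_self (hx i)

lemma closedInnerSquare_subset_innerSquare {a b : ℝ} (hab : a < b) :
    closedInnerSquare a ⊆ innerSquare b :=
  fun x hx i => ⟨by linarith [(hx i).1], by linarith [(hx i).2]⟩

lemma innerSquare_one : innerSquare 1 = unitSquare := by
  simp [innerSquare, unitSquare]

lemma innerSquare_subset_unitSquare {a : ℝ} (ha : a < 1) : innerSquare a ⊆ unitSquare := by
  rw [← innerSquare_one]
  exact (innerSquare_subset_closedInnerSquare a).trans (closedInnerSquare_subset_innerSquare ha)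

lemma mem_innerSquare_iff {a : ℝ} (ha : 0 < a) (x : Plane) :
    x ∈ innerSquare a ↔ a⁻¹ • (x - corner a) ∈ unitSquare := by
  refine forall_congr' fun i => ?_
  simp only [corner, PiLp.smul_apply, PiLp.sub_apply, smul_eq_mul, mem_Ioo]
  rw [inv_mul_eq_div, div_lt_one ha, lt_div_iff₀ ha]
  constructor <;> rintro ⟨h1, h2⟩ <;> constructor <;> linarith

lemma setIntegral_innerSquare {a : ℝ} (ha : 0 < a) (g : Plane → ℝ) :
    ∫ x in innerSquare a, g (a⁻¹ • (x - corner a)) = a ^ 2 * ∫ y in unitSquare, g y := by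
  have h : (innerSquare a).indicator (fun x => g (a⁻¹ • (x - corner a)))
      = fun x => unitSquare.indicator g (a⁻¹ • (x - corner a)) := by
    ext x
    by_cases hx : x ∈ innerSquare a
    · rw [indicator_of_mem hx, indicator_of_mem ((mem_innerSquare_iff ha x).1 hx)]
    · rw [indicator_of_notMem hx, indicator_of_notMem (mt (mem_innerSquare_iff ha x).2 hx)]
  rw [← integral_indicator (isOpen_innerSquare a).measurableSet, h,
    integral_sub_right_eq_self (fun x => unitSquare.indicator g (a⁻¹ • x)) (corner a),
    Measure.integral_comp_inv_smul, integral_indicator measurableSet_unitSquare]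
  simp

lemma volume_real_innerSquare {a : ℝ} (ha : 0 < a) : volume.real (innerSquare a) = a ^ 2 := by
  simpa [Measure.real, volume_unitSquare] using setIntegral_innerSquare ha fun _ => 1

/-- An intermediate side b leaves room for the transition. The cutoff equals 1 on a neighbourhood of
the closed inner square, hence its derivative vanishes there. -/
lemma exists_cutoff {a : ℝ} (ha : a < 1) : ∃ η : Plane → ℝ, IsTest unitSquare η ∧
    ∀ x ∈ innerSquare a, η x = 1 ∧ fderiv ℝ η x = 0 := by
  obtain ⟨b, hab, hb⟩ := exists_between ha
  have hsub : closedInnerSquare a ⊆ interior (closedInnerSquare b) :=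
    (closedInnerSquare_subset_innerSquare hab).trans
      (interior_maximal (innerSquare_subset_closedInnerSquare b) (isOpen_innerSquare b))
  obtain ⟨f, hf1, hf0, -⟩ := exists_contMDiffMap_one_nhds_of_subset_interior (n := (⊤ : ℕ∞))
    𝓘(ℝ, Plane) (isCompact_closedInnerSquare a).isClosed hsub
  have hsupp : Function.support f ⊆ closedInnerSquare b := fun x hx => by
    by_contra h
    exact hx (hf0 x h)
  refine ⟨f, ⟨f.contMDiff.contDiff,
    HasCompactSupport.of_support_subset_isCompact (isCompact_closedInnerSquare b) hsupp, ?_⟩,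
    fun x hx => ?_⟩
  · rw [← innerSquare_one]
    exact (closure_minimal hsupp (isCompact_closedInnerSquare b).isClosed).trans
      (closedInnerSquare_subset_innerSquare hb)
  · have hx1 : ∀ᶠ y in 𝓝 x, f y = 1 :=
      (nhds_le_nhdsSet (innerSquare_subset_closedInnerSquare a hx)) hf1
    refine ⟨hx1.self_of_nhds, ?_⟩
    have : (f : Plane → ℝ) =ᶠ[𝓝 x] fun _ => 1 := hx1
    rw [this.fderiv_eq]
    simp

section Test

variable {U : Set Plane} {ψ ψ' : Plane → Space}

lemma IsTest.add (h : IsTest U ψ) (h' : IsTest U ψ') : IsTest U (fun x => ψ x + ψ' x) :=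
  ⟨h.1.add h'.1, h.2.1.add h'.2.1, (tsupport_add ψ ψ').trans (union_subset h.2.2 h'.2.2)⟩

lemma IsTest.smul_clm {η : Plane → ℝ} (h : IsTest U η) (A : Plane →L[ℝ] Space) :
    IsTest U (fun x => η x • A x) :=
  ⟨h.1.smul A.contDiff, h.2.1.smul_right, (tsupport_smul_subset_left η A).trans h.2.2⟩

lemma IsTest.classicalGrad_add (h : IsTest U ψ) (h' : IsTest U ψ') (x : Plane) :
    classicalGrad (fun x => ψ x + ψ' x) x = classicalGrad ψ x + classicalGrad ψ' x := by
  simp only [classicalGrad_eq]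
  rw [fderiv_fun_add (h.1.differentiable (by simp) x) (h'.1.differentiable (by simp) x), map_add]

lemma IsTest.rescale {a : ℝ} (ha : 0 < a) (ha1 : a < 1) (h : IsTest unitSquare ψ) :
    IsTest unitSquare (fun x => a • ψ (a⁻¹ • (x - corner a))) := by
  have hcd : ContDiff ℝ ∞ fun x : Plane => a⁻¹ • (x - corner a) := by fun_prop
  have hK : IsCompact ((fun y => corner a + a • y) '' tsupport ψ) :=
    IsCompact.image h.2.1 (by fun_prop)
  have hinv : ∀ x : Plane, corner a + a • a⁻¹ • (x - corner a) = x := fun x => by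
    rw [smul_inv_smul₀ ha.ne']; abel
  have hinv' : ∀ y : Plane, a⁻¹ • (corner a + a • y - corner a) = y := fun y => by
    rw [add_sub_cancel_left, inv_smul_smul₀ ha.ne']
  have hsupp : Function.support (fun x => a • ψ (a⁻¹ • (x - corner a)))
      ⊆ (fun y => corner a + a • y) '' tsupport ψ := fun x hx => by
    refine ⟨a⁻¹ • (x - corner a), subset_tsupport ψ fun h0 => hx ?_, hinv x⟩
    change a • ψ (a⁻¹ • (x - corner a)) = 0
    rw [h0, smul_zero]
  refine ⟨(h.1.comp hcd).const_smul a,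
    HasCompactSupport.of_support_subset_isCompact hK hsupp, ?_⟩
  refine (closure_minimal hsupp hK.isClosed).trans ?_
  rintro _ ⟨y, hy, rfl⟩
  refine innerSquare_subset_unitSquare ha1 ((mem_innerSquare_iff ha _).2 ?_)
  simp only [hinv']
  exact h.2.2 hy

/-- The prefactor a cancels the a⁻¹ of the chain rule, so shrinking the domain does not change the
size of the gradient. -/
lemma IsTest.classicalGrad_rescale {a : ℝ} (ha : 0 < a) (h : IsTest U ψ) (x : Plane) :
    classicalGrad (fun x => a • ψ (a⁻¹ • (x - corner a))) x
      = classicalGrad ψ (a⁻¹ • (x - corner a)) := by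
  have h1 : HasFDerivAt (fun x : Plane => a⁻¹ • (x - corner a))
      (a⁻¹ • ContinuousLinearMap.id ℝ Plane) x :=
    ((hasFDerivAt_id x).sub_const (corner a)).const_smul a⁻¹
  have h2 : HasFDerivAt ψ (fderiv ℝ ψ (a⁻¹ • (x - corner a))) (a⁻¹ • (x - corner a)) :=
    ((h.1.differentiable (by simp)) _).hasFDerivAt
  have h3 := ((h2.comp x h1).const_smul a).fderiv
  have h4 : a • (fderiv ℝ ψ (a⁻¹ • (x - corner a))).comp (a⁻¹ • ContinuousLinearMap.id ℝ Plane)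
      = fderiv ℝ ψ (a⁻¹ • (x - corner a)) := by
    rw [ContinuousLinearMap.comp_smul, smul_inv_smul₀ ha.ne', ContinuousLinearMap.comp_id]
  rw [h4] at h3
  rw [classicalGrad_eq, classicalGrad_eq]
  exact congrArg toMat h3

lemma IsTest.classicalGrad_smul_clm {η : Plane → ℝ} (h : IsTest U η) (A : Plane →L[ℝ] Space)
    (x : Plane) : classicalGrad (fun x => η x • A x) x
      = toMat (η x • A + (fderiv ℝ η x).smulRight (A x)) := by
  rw [classicalGrad_eq]
  exact congrArg toMat
    (((h.1.differentiable (by simp) x).hasFDerivAt).smul A.hasFDerivAt).fderiv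

lemma norm_smul_add_smulRight_le {E E' : Type*} [NormedAddCommGroup E] [NormedSpace ℝ E]
    [NormedAddCommGroup E'] [NormedSpace ℝ E'] {r C₁ C₂ : ℝ} {x : E} {l : E →L[ℝ] ℝ}
    (hr : ‖r‖ ≤ C₁) (hl : ‖x‖ * ‖l‖ ≤ C₂) (A : E →L[ℝ] E') :
    ‖r • A + l.smulRight (A x)‖ ≤ (C₁ + C₂) * ‖A‖ := by
  calc ‖r • A + l.smulRight (A x)‖ ≤ ‖r‖ * ‖A‖ + ‖l‖ * ‖A x‖ := by
        refine (norm_add_le _ _).trans ?_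
        rw [norm_smul, ContinuousLinearMap.norm_smulRight_apply]
    _ ≤ ‖r‖ * ‖A‖ + ‖l‖ * (‖A‖ * ‖x‖) := by
        gcongr
        exact A.le_opNorm x
    _ = (‖r‖ + ‖x‖ * ‖l‖) * ‖A‖ := by ring
    _ ≤ (C₁ + C₂) * ‖A‖ := by gcongr

/-- The gradient is η L + Lx ⊗ ∇η, linear in L, with η and |x||∇η| bounded by compact support. That
K does not depend on L allows F' → F with the cutoff fixed. -/
lemma IsTest.exists_norm_classicalGrad_smul_ofMat_le {η : Plane → ℝ} (h : IsTest U η) :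
    ∃ K : ℝ, 0 ≤ K ∧ ∀ (L : Mat32) (x : Plane),
      ‖classicalGrad (fun x => η x • ofMat L x) x‖ ≤ K * ‖L‖ := by
  obtain ⟨C₁, hC₁⟩ := h.1.continuous.bounded_above_of_compact_support h.2.1
  have hη' : Continuous (fderiv ℝ η) := h.1.continuous_fderiv (by simp)
  have hc : Continuous fun x : Plane => ‖x‖ * ‖fderiv ℝ η x‖ := continuous_norm.mul hη'.norm
  have hs : HasCompactSupport fun x : Plane => ‖x‖ * ‖fderiv ℝ η x‖ :=
    (h.2.1.fderiv ℝ).norm.mul_left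
  obtain ⟨C₂, hC₂'⟩ := hc.bounded_above_of_compact_support hs
  have hC₂ : ∀ x : Plane, ‖x‖ * ‖fderiv ℝ η x‖ ≤ C₂ := fun x => (le_abs_self _).trans (hC₂' x)
  have hC₁0 : 0 ≤ C₁ := (norm_nonneg _).trans (hC₁ 0)
  have hC₂0 : 0 ≤ C₂ := (norm_nonneg _).trans (hC₂' 0)
  obtain ⟨C₃, hC₃0, hC₃⟩ := toMat.bound
  obtain ⟨C₄, hC₄0, hC₄⟩ := ofMat.bound
  refine ⟨C₃ * ((C₁ + C₂) * C₄), by positivity, fun L x => ?_⟩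
  rw [h.classicalGrad_smul_clm]
  calc _ ≤ C₃ * ((C₁ + C₂) * ‖ofMat L‖) := (hC₃ _).trans
        (mul_le_mul_of_nonneg_left (norm_smul_add_smulRight_le (hC₁ x) (hC₂ x) (ofMat L)) hC₃0.le)
    _ ≤ C₃ * ((C₁ + C₂) * (C₄ * ‖L‖)) := by
        gcongr
        exact hC₄ L
    _ = _ := by ring

/-- A test function can be shrunk to a smaller concentric square and given an additional affine
part there, at the cost of a gradient proportional to that part in the remaining frame. -/
lemma exists_isTest_add_affine {a : ℝ} (ha : 0 < a) (ha1 : a < 1) : ∃ K : ℝ, 0 ≤ K ∧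
    ∀ (ψ : Plane → Space), IsTest unitSquare ψ → ∀ L : Mat32,
      ∃ Φ : Plane → Space, IsTest unitSquare Φ ∧
        (∀ x ∈ innerSquare a,
          classicalGrad Φ x = L + classicalGrad ψ (a⁻¹ • (x - corner a))) ∧
        ∀ x ∉ innerSquare a, ‖classicalGrad Φ x‖ ≤ K * ‖L‖ := by
  obtain ⟨η, hη, hη1⟩ := exists_cutoff ha1
  obtain ⟨K, hK, hKL⟩ := hη.exists_norm_classicalGrad_smul_ofMat_le
  refine ⟨K, hK, fun ψ hψ L => ⟨_, (hη.smul_clm (ofMat L)).add (hψ.rescale ha ha1),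
    fun x hx => ?_, fun x hx => ?_⟩⟩ <;>
  rw [(hη.smul_clm (ofMat L)).classicalGrad_add (hψ.rescale ha ha1), hψ.classicalGrad_rescale ha]
  · rw [hη.classicalGrad_smul_clm, (hη1 x hx).1, (hη1 x hx).2]
    simp [toMat_ofMat]
  · rw [hψ.classicalGrad_eq_zero (mt (mem_innerSquare_iff ha x).2 hx), add_zero]
    exact hKL L x

end Test

/-! ### Continuity of the envelope -/

section

variable {p β' β : ℝ} {V : Mat32 → ℝ}

/-- With L = F' - F, the modified competitor has total gradient F' + ∇ψ, rescaled, on the inner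
square. On the frame the total gradient is at most |F| + K|F' - F|, where the upper growth bound
suffices. -/
lemma IsDensity.exists_qcEnvelope_le (hV : IsDensity p β' β V) (hp : 1 ≤ p) (hβ' : 0 < β')
    (hββ' : β' ≤ β) {a : ℝ} (ha : 0 < a) (ha1 : a < 1) : ∃ K : ℝ, 0 ≤ K ∧ ∀ F F' : Mat32,
      qcEnvelope p V F ≤ a ^ 2 * qcEnvelope p V F'
        + (1 - a ^ 2) * (β * (1 + (‖F‖ + K * ‖F' - F‖) ^ p)) := by
  have hp0 : 0 < p := by linarith
  have hβ : 0 ≤ β := hβ'.le.trans hββ'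
  obtain ⟨K, hK, hKΦ⟩ := exists_isTest_add_affine ha ha1
  refine ⟨K, hK, fun F F' => ?_⟩
  set B := (1 - a ^ 2) * (β * (1 + (‖F‖ + K * ‖F' - F‖) ^ p)) with hB
  have ha2 : 0 < a ^ 2 := by positivity
  suffices h : (qcEnvelope p V F - B) / a ^ 2 ≤ qcEnvelope p V F' by
    rw [div_le_iff₀ ha2] at h
    linarith
  refine le_qcEnvelope fun φ G hφ => le_of_forall_pos_le_add fun ε hε => ?_
  obtain ⟨ψ, hψ, hψlt⟩ := hV.exists_isTest_integral_lt hp hβ' hββ' hφ F' hε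
  refine le_trans ?_ hψlt.le
  obtain ⟨Φ, hΦ, hΦin, hΦout⟩ := hKΦ ψ hψ (F' - F)
  have hint : IntegrableOn (fun x => V (F + classicalGrad Φ x)) unitSquare :=
    hV.integrable hp0 hβ' hββ' ((memLp_const F).add (hΦ.memW01p p).1.2.1)
  have hsub := innerSquare_subset_unitSquare ha1
  have hms := (isOpen_innerSquare a).measurableSet
  have hin : ∫ x in innerSquare a, V (F + classicalGrad Φ x)
      = a ^ 2 * ∫ y in unitSquare, V (F' + classicalGrad ψ y) := by
    rw [← setIntegral_innerSquare ha]
    refine setIntegral_congr_fun hms fun x hx => ?_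
    simp only [hΦin x hx]
    congr 1
    abel
  have hfin : volume (unitSquare \ innerSquare a) ≠ ⊤ :=
    measure_ne_top_of_subset sdiff_subset (by simp [volume_unitSquare])
  have hvol : volume.real (unitSquare \ innerSquare a) = 1 - a ^ 2 := by
    rw [measureReal_sdiff hsub hms (by simp [volume_unitSquare]),
      volume_real_innerSquare ha]
    simp [Measure.real, volume_unitSquare]
  have hout : ∫ x in unitSquare \ innerSquare a, V (F + classicalGrad Φ x) ≤ B := by
    calc _ ≤ ∫ _ in unitSquare \ innerSquare a, β * (1 + (‖F‖ + K * ‖F' - F‖) ^ p) := by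
          refine setIntegral_mono_on (hint.mono_set sdiff_subset)
            (integrableOn_const hfin) (measurableSet_unitSquare.diff hms) fun x hx => ?_
          refine (hV.upper _).trans ?_
          gcongr
          exact (norm_add_le _ _).trans (by gcongr; exact hΦout x hx.2)
      _ = B := by rw [setIntegral_const, hvol, smul_eq_mul]
  have hle := hV.qcEnvelope_le_integral hp hβ' hββ' (hΦ.memW01p p) F
  have hsplit : ∫ x in unitSquare, V (F + classicalGrad Φ x)
      = (∫ x in innerSquare a, V (F + classicalGrad Φ x))
        + ∫ x in unitSquare \ innerSquare a, V (F + classicalGrad Φ x) := by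
    rw [setIntegral_sdiff hms hint hsub]
    ring
  rw [div_le_iff₀ ha2]
  linarith

lemma IsDensity.continuous_qcEnvelope (hV : IsDensity p β' β V) (hp : 1 ≤ p) (hβ' : 0 < β')
    (hββ' : β' ≤ β) : Continuous (qcEnvelope p V) := by
  have hp0 : 0 < p := by linarith
  have hβ : 0 ≤ β := hβ'.le.trans hββ'
  refine continuous_iff_continuousAt.2 fun F => Metric.continuousAt_iff'.2 fun ε hε => ?_
  -- One unit of the 2 covers |F'| ≤ |F| + 1, the other K|F' - F| < 1. Only a is chosen from ε; K
  -- then depends on a, and the neighbourhood of F on K.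
  set B := β * (1 + (‖F‖ + 2) ^ p) with hB
  obtain ⟨a, ha, ha1, haε⟩ : ∃ a : ℝ, 0 < a ∧ a < 1 ∧ (1 - a ^ 2) * (2 * B) < ε := by
    have h1 : Tendsto (fun a : ℝ => (1 - a ^ 2) * (2 * B)) (𝓝[<] 1) (𝓝 0) := by
      have : Continuous fun a : ℝ => (1 - a ^ 2) * (2 * B) := by fun_prop
      simpa using (this.tendsto 1).mono_left nhdsWithin_le_nhds
    obtain ⟨a, h4, h2, h3⟩ := ((h1.eventually (gt_mem_nhds hε)).and
      (Ioo_mem_nhdsLT (zero_lt_one' ℝ))).exists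
    exact ⟨a, h2, h3, h4⟩
  obtain ⟨K, hK, hKle⟩ := hV.exists_qcEnvelope_le hp hβ' hββ' ha ha1
  have hd : Tendsto (fun F' => ‖F' - F‖) (𝓝 F) (𝓝 0) := tendsto_iff_norm_sub_tendsto_zero.1 tendsto_id
  have hKd : Tendsto (fun F' => K * ‖F' - F‖) (𝓝 F) (𝓝 0) := by simpa using hd.const_mul K
  filter_upwards [hd.eventually (gt_mem_nhds one_pos), hKd.eventually (gt_mem_nhds one_pos)]
    with F' h1 h2
  have hF' : ‖F'‖ ≤ ‖F‖ + 1 := by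
    have := norm_add_le F (F' - F)
    rw [add_sub_cancel] at this
    linarith
  have ha2 : 0 ≤ 1 - a ^ 2 := by nlinarith
  have hbound : ∀ t : ℝ, 0 ≤ t → t ≤ ‖F‖ + 2 → β * (1 + t ^ p) ≤ B := fun t ht ht' => by
    rw [hB]; gcongr
  have e1 := (_root_.abs_le.1 (hV.abs_qcEnvelope_le hp hβ' hββ' F)).1
  have e2 := (_root_.abs_le.1 (hV.abs_qcEnvelope_le hp hβ' hββ' F')).1
  have b1 := hbound ‖F‖ (norm_nonneg _) (by linarith)
  have b2 := hbound ‖F'‖ (norm_nonneg _) (by linarith)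
  have b3 := hbound (‖F‖ + K * ‖F' - F‖) (by positivity) (by linarith)
  have b4 := hbound (‖F'‖ + K * ‖F - F'‖) (by positivity)
    (by rw [norm_sub_rev F F']; linarith)
  have c1 := hKle F F'
  have c2 := hKle F' F
  have d1 := mul_le_mul_of_nonneg_left b3 ha2
  have d2 := mul_le_mul_of_nonneg_left b4 ha2
  -- Writing a² QV = QV - (1 - a²) QV and using QV ≥ -B, the factor a² costs at most (1 - a²)B, as
  -- does the frame; hence the 2B in the choice of a.
  have g1 := mul_le_mul_of_nonneg_left (e1.trans' (neg_le_neg b1)) ha2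
  have g2 := mul_le_mul_of_nonneg_left (e2.trans' (neg_le_neg b2)) ha2
  rw [Real.dist_eq, abs_lt]
  constructor <;> linarith

end

/-! ### The two-phase density and the theorem -/

lemma isDensity_Vbar {p β' β : ℝ} {W₁ W₂ : Mat33 → ℝ} (hp : 0 < p) (hβ' : 0 < β') (hββ' : β' ≤ β)
    (hW₁ : Continuous W₁) (hW₂ : Continuous W₂)
    (hg₁ : HasGrowth p β' β W₁) (hg₂ : HasGrowth p β' β W₂) {χ : ℝ} (hχ : χ ∈ ({0, 1} : Set ℝ)) :
    IsDensity p β' β (Vbar W₁ W₂ χ) := by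
  have key : ∀ W : Mat33 → ℝ, Continuous W → HasGrowth p β' β W →
      IsDensity p β' β (reduced W) := fun W hW hg =>
    ⟨hg.continuous_reduced hp hβ' (hβ'.le.trans hββ') hW, hg.le_reduced hp hβ',
      hg.reduced_le hp hβ'⟩
  rcases hχ with rfl | rfl
  · convert key W₂ hW₂ hg₂ using 1
    ext F
    simp [Vbar]
  · convert key W₁ hW₁ hg₁ using 1
    ext F
    simp [Vbar]

lemma QVbar_eq_qcEnvelope (p : ℝ) (W₁ W₂ : Mat33 → ℝ) (χ : ℝ) :
    QVbar p W₁ W₂ χ = qcEnvelope p (Vbar W₁ W₂ χ) := rfl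

end ThinFilm

theorem proposition2 (p β' β : ℝ) (hp : 1 < p) (hβ' : 0 < β') (hββ' : β' ≤ β)
    (W₁ W₂ : ThinFilm.Mat33 → ℝ) (hW₁ : Continuous W₁) (hW₂ : Continuous W₂)
    (hg₁ : ThinFilm.HasGrowth p β' β W₁) (hg₂ : ThinFilm.HasGrowth p β' β W₂) :
    ContinuousOn (fun q : ℝ × ThinFilm.Mat32 => ThinFilm.QVbar p W₁ W₂ q.1 q.2)
      (({0, 1} : Set ℝ) ×ˢ Set.univ) ∧
    (∀ χ ∈ ({0, 1} : Set ℝ), ∀ F : ThinFilm.Mat32,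
      β' * (‖F‖ ^ p - 1) ≤ ThinFilm.QVbar p W₁ W₂ χ F ∧
      ThinFilm.QVbar p W₁ W₂ χ F ≤ β * (1 + ‖F‖ ^ p)) ∧
    ∃ C : ℝ, 0 < C ∧ ∀ χ ∈ ({0, 1} : Set ℝ), ∀ χ' ∈ ({0, 1} : Set ℝ), ∀ F : ThinFilm.Mat32,
      |ThinFilm.QVbar p W₁ W₂ χ F - ThinFilm.QVbar p W₁ W₂ χ' F|
        ≤ C * |χ - χ'| * (1 + ‖F‖ ^ p) := by
  have hD := fun {χ : ℝ} (hχ : χ ∈ ({0, 1} : Set ℝ)) =>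
    ThinFilm.isDensity_Vbar (by linarith) hβ' hββ' hW₁ hW₂ hg₁ hg₂ hχ
  refine ⟨?_, fun χ hχ F => (hD hχ).qcEnvelope_growth hp.le hβ' hββ' F,
    2 * β, by linarith, fun χ hχ χ' hχ' F => ?_⟩
  · have h0 := (hD (χ := 0) (by simp)).continuous_qcEnvelope hp.le hβ' hββ'
    have h1 := (hD (χ := 1) (by simp)).continuous_qcEnvelope hp.le hβ' hββ'
    -- Affine interpolation in χ between the two envelopes is jointly continuous and agrees with QV̄
    -- at χ = 0 and χ = 1.
    have hc : Continuous fun q : ℝ × ThinFilm.Mat32 =>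
        q.1 * ThinFilm.qcEnvelope p (ThinFilm.Vbar W₁ W₂ 1) q.2
          + (1 - q.1) * ThinFilm.qcEnvelope p (ThinFilm.Vbar W₁ W₂ 0) q.2 := by fun_prop
    refine hc.continuousOn.congr ?_
    rintro ⟨χ, F⟩ ⟨hχ, -⟩
    rcases hχ with h | h <;> obtain rfl : χ = _ := h <;>
      simp [ThinFilm.QVbar_eq_qcEnvelope]
  · have b1 := (hD hχ).abs_qcEnvelope_le hp.le hβ' hββ' F
    have b2 := (hD hχ').abs_qcEnvelope_le hp.le hβ' hββ' F
    by_cases h : χ = χ'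
    · simp [h]
    -- Distinct phases are at distance 1, so adding the two absolute growth bounds suffices, whence
    -- the constant 2β.
    · have h1 : |χ - χ'| = 1 := by
        rcases hχ with rfl | rfl <;> rcases hχ' with rfl | rfl <;> simp_all
      rw [h1]
      have := abs_sub (ThinFilm.QVbar p W₁ W₂ χ F) (ThinFilm.QVbar p W₁ W₂ χ' F)
      simp only [ThinFilm.QVbar_eq_qcEnvelope] at this ⊢
      linarith
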